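/- Let $I\subset\mathbb{R}$ be a bounded interval and let $\mu$ be a finite positive Borel measure on $I$. Write $\mu=f\,\mathcal{L}^1+\mu_s$, where $f:I\to[0,+\infty]$ is the density of the absolutely continuous part of $\mu$ and $\mu_s$ is the singular part of $\mu$ with respect to the Lebesgue measure $\mathcal{L}^1$. Let $A$ be a Lebesgue-negligible set on which $\mu_s$ is concentrated, and set $$M=\Big\{x\in I:\ \forall\varepsilon>0,\ \int_{I\cap\,]x-\varepsilon,x+\varepsilon[}\frac{dt}{f(t)}=+\infty\Big\},$$ where $1/f=+\infty$ wherever $f=0$ (and $1/f=0$ wherever $f=+\infty$). Let $\Gamma(0)\subset L^2_\mu=L^2(I,\mu)$ be the set of all $v\in L^2_\mu$ for which there is a sequence $(u_n)_n$ in $C^\infty(\overline I)$, that is, of restrictions to $\overline I$ of $C^\infty$ functions on $\mathbb{R}$ whose derivatives are denoted by $u_n'$, such that $u_n\to 0$ and $u_n'\to v$ in $L^2_\mu$; it is a closed linear subspace of $L^2_\mu$. Let $\xi\in L^2_\mu$ be the orthogonal projection in $L^2_\mu$ of the constant function $1$ onto $\Gamma(0)$, and define the tangent space to $\mu$ at $x$,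 for $\mu$-a.e. $x\in I$, by $T_\mu(x)=(\mathbb{R}\,\xi(x))^{\perp}\subset\mathbb{R}$. Then, for $\mu$-a.e. $x\in I$, $$T_\mu(x)=\begin{cases}\{0\}&\text{if }x\in M\cup A,\\ \mathbb{R}&\text{otherwise.}\end{cases}$$ -/

import Mathlib

open MeasureTheory Filter Topology
open scoped ENNReal ContDiff

noncomputable section

namespace ZhikovTangent

/-- `GradientSet μ u` is the set `Γ(u)` of gradients of `u` with respect to `μ`: all `v ∈ L²_μ` such
that some sequence of smooth functions satisfies `uₙ → u` and `uₙ' → v` for the `L²_μ`-norm.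
For `μ` carried by a bounded interval `I`, the restrictions to the closure of `I` of smooth functions
on `ℝ` are exactly the functions of class `C^∞` up to the boundary of `I`. -/
def GradientSet (μ : Measure ℝ) (u : Lp ℝ 2 μ) : Set (Lp ℝ 2 μ) :=
  {v | ∃ w : ℕ → ℝ → ℝ, (∀ n, ContDiff ℝ ∞ (w n)) ∧
    Tendsto (fun n => eLpNorm (fun x => w n x - u x) 2 μ) atTop (𝓝 0) ∧
    Tendsto (fun n => eLpNorm (fun x => deriv (w n) x - v x) 2 μ) atTop (𝓝 0)}

theorem mem_gradientSet_iff {μ : Measure ℝ} {u v : Lp ℝ 2 μ} :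
    v ∈ GradientSet μ u ↔ ∀ ε : ℝ≥0∞, 0 < ε → ∃ w : ℝ → ℝ, ContDiff ℝ ∞ w ∧
      eLpNorm (fun x => w x - u x) 2 μ < ε ∧ eLpNorm (fun x => deriv w x - v x) 2 μ < ε := by
  constructor
  · rintro ⟨w, hw, h1, h2⟩ ε hε
    obtain ⟨n, hn1, hn2⟩ := ((h1.eventually_lt_const hε).and (h2.eventually_lt_const hε)).exists
    exact ⟨w n, hw n, hn1, hn2⟩
  · intro h
    have hpos : ∀ n : ℕ, (0 : ℝ≥0∞) < ((n : ℝ≥0∞))⁻¹ := fun n =>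
      ENNReal.inv_pos.2 (ENNReal.natCast_ne_top n)
    choose w hw h1 h2 using fun n : ℕ => h _ (hpos n)
    refine ⟨w, hw, ?_, ?_⟩
    · exact tendsto_of_tendsto_of_tendsto_of_le_of_le tendsto_const_nhds
        ENNReal.tendsto_inv_nat_nhds_zero (fun _ => zero_le) (fun n => (h1 n).le)
    · exact tendsto_of_tendsto_of_tendsto_of_le_of_le tendsto_const_nhds
        ENNReal.tendsto_inv_nat_nhds_zero (fun _ => zero_le) (fun n => (h2 n).le)

theorem aesm_sub {μ : Measure ℝ} {w : ℝ → ℝ} (hw : Continuous w) (u : Lp ℝ 2 μ) :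
    AEStronglyMeasurable (fun x => w x - u x) μ :=
  hw.aestronglyMeasurable.sub (Lp.aestronglyMeasurable u)

theorem gradientSet_add {μ : Measure ℝ} {u₁ u₂ v₁ v₂ : Lp ℝ 2 μ} (h₁ : v₁ ∈ GradientSet μ u₁)
    (h₂ : v₂ ∈ GradientSet μ u₂) : v₁ + v₂ ∈ GradientSet μ (u₁ + u₂) := by
  obtain ⟨w₁, hw₁, a₁, b₁⟩ := h₁
  obtain ⟨w₂, hw₂, a₂, b₂⟩ := h₂
  refine ⟨fun n x => w₁ n x + w₂ n x, fun n => (hw₁ n).add (hw₂ n), ?_, ?_⟩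
  · refine tendsto_of_tendsto_of_tendsto_of_le_of_le tendsto_const_nhds
      (by simpa using a₁.add a₂) (fun _ => zero_le) (fun n => ?_)
    refine le_trans (le_of_eq (eLpNorm_congr_ae ?_)) (eLpNorm_add_le
      (aesm_sub (hw₁ n).continuous u₁) (aesm_sub (hw₂ n).continuous u₂) (by norm_num))
    filter_upwards [Lp.coeFn_add u₁ u₂] with x hx
    simp only [hx, Pi.add_apply]; ring
  · refine tendsto_of_tendsto_of_tendsto_of_le_of_le tendsto_const_nhds
      (by simpa using b₁.add b₂) (fun _ => zero_le) (fun n => ?_)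
    refine le_trans (le_of_eq (eLpNorm_congr_ae ?_)) (eLpNorm_add_le
      (aesm_sub ((hw₁ n).continuous_deriv (by simp)) v₁)
      (aesm_sub ((hw₂ n).continuous_deriv (by simp)) v₂) (by norm_num))
    filter_upwards [Lp.coeFn_add v₁ v₂] with x hx
    have e : deriv (fun y => w₁ n y + w₂ n y) x = deriv (w₁ n) x + deriv (w₂ n) x :=
      deriv_fun_add ((hw₁ n).differentiable (by simp) x) ((hw₂ n).differentiable (by simp) x)
    simp only [hx, Pi.add_apply, e]; ring

theorem gradientSet_smul {μ : Measure ℝ} {u v : Lp ℝ 2 μ} (c : ℝ) (h : v ∈ GradientSet μ u) :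
    c • v ∈ GradientSet μ (c • u) := by
  obtain ⟨w, hw, a, b⟩ := h
  refine ⟨fun n x => c * w n x, fun n => contDiff_const.mul (hw n), ?_, ?_⟩
  · have key := ENNReal.Tendsto.const_mul (a := ‖c‖ₑ) a (Or.inr (by simp))
    rw [mul_zero] at key
    refine key.congr fun n => ?_
    rw [← eLpNorm_const_smul]
    refine eLpNorm_congr_ae ?_
    filter_upwards [Lp.coeFn_smul c u] with x hx
    simp only [hx, Pi.smul_apply, smul_eq_mul]; ring
  · have key := ENNReal.Tendsto.const_mul (a := ‖c‖ₑ) b (Or.inr (by simp))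
    rw [mul_zero] at key
    refine key.congr fun n => ?_
    rw [← eLpNorm_const_smul]
    refine eLpNorm_congr_ae ?_
    filter_upwards [Lp.coeFn_smul c v] with x hx
    have e : deriv (fun y => c * w n y) x = c * deriv (w n) x :=
      deriv_const_mul c ((hw n).differentiable (by simp) x)
    simp only [hx, Pi.smul_apply, smul_eq_mul, e]; ring

theorem zero_mem_gradientSet (μ : Measure ℝ) : (0 : Lp ℝ 2 μ) ∈ GradientSet μ 0 := by
  refine ⟨fun _ _ => 0, fun _ => contDiff_const, ?_, ?_⟩
  all_goals
    refine tendsto_const_nhds.congr fun n => ?_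
    rw [← eLpNorm_zero (p := 2) (μ := μ) (α := ℝ) (ε := ℝ)]
    refine eLpNorm_congr_ae ?_
    filter_upwards [Lp.coeFn_zero ℝ 2 μ] with x hx
    rw [hx]
    simp

theorem isClosed_gradientSet (μ : Measure ℝ) (u : Lp ℝ 2 μ) : IsClosed (GradientSet μ u) := by
  refine isClosed_of_closure_subset fun v hv => ?_
  rw [mem_gradientSet_iff]
  intro ε hε
  obtain ⟨v', hv', hd⟩ := EMetric.mem_closure_iff.1 hv (ε / 2) (ENNReal.half_pos hε.ne')
  obtain ⟨w, hw, h1, h2⟩ := mem_gradientSet_iff.1 hv' (ε / 2) (ENNReal.half_pos hε.ne')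
  refine ⟨w, hw, h1.trans_le ENNReal.half_le_self, ?_⟩
  rw [edist_comm, Lp.edist_def] at hd
  calc eLpNorm (fun x => deriv w x - v x) 2 μ
      = eLpNorm ((fun x => deriv w x - v' x) + (fun x => v' x - v x)) 2 μ := by
        congr 1; ext x; simp
    _ ≤ eLpNorm (fun x => deriv w x - v' x) 2 μ + eLpNorm (fun x => v' x - v x) 2 μ :=
        eLpNorm_add_le (aesm_sub (hw.continuous_deriv (by simp)) v')
          ((Lp.aestronglyMeasurable v').sub (Lp.aestronglyMeasurable v)) (by norm_num)
    _ < ε / 2 + ε / 2 := ENNReal.add_lt_add h2 hd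
    _ = ε := ENNReal.add_halves ε

/-- The closed linear subspace `Γ(0)` of `L²_μ`. -/
def gradientsOfZero (μ : Measure ℝ) : Submodule ℝ (Lp ℝ 2 μ) where
  carrier := GradientSet μ 0
  zero_mem' := zero_mem_gradientSet μ
  add_mem' h₁ h₂ := by simpa using gradientSet_add h₁ h₂
  smul_mem' c _ h := by simpa using gradientSet_smul c h

instance (μ : Measure ℝ) : CompleteSpace (gradientsOfZero μ) :=
  (isClosed_gradientSet μ 0).completeSpace_coe

/-- The function `ξ`, the orthogonal projection in `L²_μ` of the constant function `e₁ = 1`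
onto `Γ(0)`. -/
def xi (μ : Measure ℝ) [IsFiniteMeasure μ] : Lp ℝ 2 μ :=
  (gradientsOfZero μ).starProjection (Lp.const 2 μ (1 : ℝ))

/-- The tangent space `T_μ(x)`, the orthogonal complement in `ℝ` of the span of `ξ(x)`. It is defined
for `μ`-almost every `x`, since `ξ` is a class of functions modulo `μ`-a.e. equality. -/
def tangentSpace (μ : Measure ℝ) [IsFiniteMeasure μ] (x : ℝ) : Submodule ℝ ℝ :=
  (Submodule.span ℝ {xi μ x})ᗮ

/-- The points of `I` near which `1/f` is not integrable. Here `1/f = ∞` wherever `f = 0`. -/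
def criticalSet (I : Set ℝ) (f : ℝ → ℝ≥0∞) : Set ℝ :=
  {x ∈ I | ∀ ε : ℝ, 0 < ε → ∫⁻ t in I ∩ Metric.ball x ε, 1 / f t = ⊤}

end ZhikovTangent

end

namespace ZhikovTangent

/-! Let S be a Lebesgue-null Borel set carrying the singular part. The projection ξ is the indicator
of M ∪ S: this indicator lies in Γ(0), and every element of Γ(0) vanishes μ-a.e. off M ∪ S, so that
1 minus the indicator is orthogonal to Γ(0).

Vanishing: a point of I outside M has a neighbourhood J in I with 1/f integrable. By Cauchy–Schwarz,
L²_μ-convergence forces L¹(J)-convergence, so a limit of uₙ' with uₙ → 0 is the distributional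
derivative of 0 on J (`ae_restrict_eq_zero_of_mem_gradientSet_zero`).

Membership: it suffices to approximate the indicator in L²_μ by functions with uniformly small
primitives (`mem_gradientSet_zero_of_primitive_small`). The set S contributes nothing to primitives.
For M, cut the line into short cells; where M has positive measure in a cell, 1/f has infinite
integral there, so the mass of M in the cell can be cancelled at negligible L²_μ cost
(`exists_integral_eq_one_lintegral_sq_le`). The primitive then returns to 0 after each cell and is
bounded by the cell length (`exists_eLpNorm_sub_indicator_le`). -/

/-! ### Membership in Γ(0) through small primitives -/

theorem contDiff_primitive {h : ℝ → ℝ} (hh : ContDiff ℝ ∞ h) (a : ℝ) :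
    ContDiff ℝ ∞ (fun x => ∫ t in a..x, h t) := by
  have hd : ∀ x, HasDerivAt (fun x => ∫ t in a..x, h t) (h x) x := fun x =>
    (hh.continuous.integral_hasStrictDerivAt a x).hasDerivAt
  rw [contDiff_infty_iff_deriv]
  refine ⟨fun x => (hd x).differentiableAt, ?_⟩
  rwa [show deriv (fun x => ∫ t in a..x, h t) = h from funext fun x => (hd x).deriv]

/-- Hölder's inequality against the constant 1; it turns a Lebesgue L² error on a function into a
uniform error on its primitive. -/
theorem enorm_intervalIntegral_le {a b x : ℝ} (hx : x ∈ Set.Icc a b) (r : ℝ → ℝ)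
    (hr : AEStronglyMeasurable r (volume.restrict (Set.Icc a b))) :
    ‖∫ t in a..x, r t‖ₑ ≤
      eLpNorm r 2 (volume.restrict (Set.Icc a b)) * (volume (Set.Icc a b)) ^ (1 / 2 : ℝ) := by
  rw [intervalIntegral.integral_of_le hx.1]
  calc ‖∫ t in Set.Ioc a x, r t‖ₑ ≤ ∫⁻ t in Set.Ioc a x, ‖r t‖ₑ := enorm_integral_le_lintegral_enorm _
    _ ≤ ∫⁻ t in Set.Icc a b, ‖r t‖ₑ :=
        lintegral_mono_set (Set.Ioc_subset_Icc_self.trans (Set.Icc_subset_Icc_right hx.2))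
    _ = eLpNorm r 1 (volume.restrict (Set.Icc a b)) := eLpNorm_one_eq_lintegral_enorm.symm
    _ ≤ _ := by
        refine (eLpNorm_le_eLpNorm_mul_rpow_measure_univ (p := 1) (q := 2) (by norm_num) hr).trans ?_
        simp only [Measure.restrict_apply_univ]
        norm_num

/-- A function of `L²_μ` belongs to `Γ(0)` as soon as it is a limit in `L²_μ` of functions, square
integrable also for the Lebesgue measure, whose primitives are uniformly small. -/
theorem mem_gradientSet_zero_of_primitive_small {μ : Measure ℝ} [IsFiniteMeasure μ] {a b : ℝ}
    (hμ : μ (Set.Icc a b)ᶜ = 0) {v : Lp ℝ 2 μ}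
    (H : ∀ ε : ℝ, 0 < ε → ∃ g : ℝ → ℝ, MemLp g 2 (μ + volume.restrict (Set.Icc a b)) ∧
      (∀ x ∈ Set.Icc a b, |∫ t in a..x, g t| ≤ ε) ∧
      eLpNorm (fun x => g x - v x) 2 μ ≤ ENNReal.ofReal ε) :
    v ∈ GradientSet μ 0 := by
  rw [mem_gradientSet_iff]
  intro ε hε
  -- With tolerance δ, the first summand times δ bounds the L²_μ norm of the smooth primitive, and
  -- 2δ bounds the error on its derivative.
  set K : ℝ≥0∞ := (1 + (volume (Set.Icc a b)) ^ (1 / 2 : ℝ)) * (μ Set.univ) ^ (1 / 2 : ℝ) + 2 with hK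
  have hKt : K ≠ ⊤ := by
    refine ENNReal.add_ne_top.2 ⟨ENNReal.mul_ne_top (ENNReal.add_ne_top.2 ⟨by simp, ?_⟩) ?_, by simp⟩
    · exact ENNReal.rpow_ne_top_of_nonneg (by norm_num) (by simp)
    · exact ENNReal.rpow_ne_top_of_nonneg (by norm_num) (by simp)
  obtain ⟨δ, hδ, hδε⟩ : ∃ δ : ℝ, 0 < δ ∧ ENNReal.ofReal δ * K < ε := by
    have h1 : Tendsto (fun δ : ℝ => ENNReal.ofReal δ * K) (𝓝[>] 0) (𝓝 0) := by
      have := ENNReal.Tendsto.mul_const (b := K) (ENNReal.tendsto_ofReal (tendsto_id (x := 𝓝 (0 : ℝ))))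
        (Or.inr hKt)
      simpa using this.mono_left nhdsWithin_le_nhds
    obtain ⟨δ, h2, h3⟩ := ((h1.eventually_lt_const hε).and self_mem_nhdsWithin).exists
    exact ⟨δ, h3, h2⟩
  obtain ⟨g, hg, hg1, hg2⟩ := H δ hδ
  -- Approximating for μ plus Lebesgue measure lets one smooth h serve twice: the μ part controls
  -- the derivative, the Lebesgue part the primitive.
  obtain ⟨h, -, hh, hgh⟩ := hg.exist_eLpNorm_sub_le (by simp) (by norm_num) hδ
  have hgv : MemLp g 2 (volume.restrict (Set.Icc a b)) := hg.mono_measure (Measure.le_add_left le_rfl)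
  have hgm : MemLp g 2 μ := hg.mono_measure (Measure.le_add_right le_rfl)
  have hmu : eLpNorm (g - h) 2 μ ≤ ENNReal.ofReal δ :=
    (eLpNorm_mono_measure _ (Measure.le_add_right le_rfl)).trans hgh
  have hvol : eLpNorm (g - h) 2 (volume.restrict (Set.Icc a b)) ≤ ENNReal.ofReal δ :=
    (eLpNorm_mono_measure _ (Measure.le_add_left le_rfl)).trans hgh
  refine ⟨fun x => ∫ t in a..x, h t, contDiff_primitive hh a, ?_, ?_⟩
  · have hb : ∀ᵐ x ∂μ, ‖(∫ t in a..x, h t) - (0 : Lp ℝ 2 μ) x‖ₑ ≤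
        ENNReal.ofReal δ * (1 + (volume (Set.Icc a b)) ^ (1 / 2 : ℝ)) := by
      have hI : ∀ᵐ x ∂μ, x ∈ Set.Icc a b := hμ
      filter_upwards [Lp.coeFn_zero ℝ 2 μ, hI] with x hx0 hx
      have hsub : Set.uIcc a x ⊆ Set.Icc a b := by
        rw [Set.uIcc_of_le hx.1]; exact Set.Icc_subset_Icc_right hx.2
      have hgi : IntervalIntegrable g volume a x :=
        (show IntegrableOn g (Set.uIcc a x) from (hgv.integrable (by norm_num)).mono_measure
          (Measure.restrict_mono hsub le_rfl)).intervalIntegrable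
      have e : ∫ t in a..x, h t = (∫ t in a..x, g t) - ∫ t in a..x, (g - h) t := by
        have := intervalIntegral.integral_sub hgi (hh.continuous.intervalIntegrable a x)
        simp only [Pi.sub_apply]
        rw [this]; ring
      rw [hx0, Pi.zero_apply, sub_zero, e, mul_add, mul_one]
      refine enorm_sub_le.trans (add_le_add ?_ ?_)
      · rw [Real.enorm_eq_ofReal_abs]; exact ENNReal.ofReal_le_ofReal (hg1 x hx)
      · exact (enorm_intervalIntegral_le hx _
          (hgv.aestronglyMeasurable.sub hh.continuous.aestronglyMeasurable)).trans (by gcongr)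
    refine (eLpNorm_mono_enorm_ae (g := fun _ =>
      ENNReal.ofReal δ * (1 + (volume (Set.Icc a b)) ^ (1 / 2 : ℝ))) hb).trans_lt
      (lt_of_le_of_lt ?_ hδε)
    rcases eq_or_ne μ 0 with h0 | h0
    · simp [h0]
    rw [eLpNorm_const _ (by simp) h0, hK, mul_add (ENNReal.ofReal δ) (_ * _) 2, ← mul_assoc]
    simp
  · have e : ∀ x, deriv (fun x => ∫ t in a..x, h t) x - v x = (g x - v x) - (g - h) x := by
      intro x
      rw [hh.continuous.deriv_integral]
      simp
    simp only [e]
    refine (eLpNorm_sub_le (hgm.aestronglyMeasurable.sub (Lp.aestronglyMeasurable v))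
      (hgm.aestronglyMeasurable.sub hh.continuous.aestronglyMeasurable) (by norm_num)).trans_lt
      (lt_of_le_of_lt ((add_le_add hg2 hmu).trans ?_) hδε)
    rw [← mul_two]
    gcongr
    exact le_add_self

/-! ### Unit mass at small cost -/

/-- If `1/f` is not integrable on `J`, then there are bounded functions carried by `J` of integral
`1` and of arbitrarily small norm in `L²(f)`. -/
theorem exists_integral_eq_one_lintegral_sq_le {α : Type*} [MeasurableSpace α] {ν : Measure α}
    {J : Set α} (hJ : MeasurableSet J) (hνJ : ν J ≠ ⊤) {f : α → ℝ≥0∞} (hf : Measurable f)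
    (hinf : ∫⁻ t in J, 1 / f t ∂ν = ⊤) {ε : ℝ≥0∞} (hε : ε ≠ 0) :
    ∃ h : α → ℝ, Measurable h ∧ (∀ x, 0 ≤ h x) ∧ (∃ C, ∀ x, h x ≤ C) ∧ (∀ x ∉ J, h x = 0) ∧
      Integrable h ν ∧ ∫ x, h x ∂ν = 1 ∧ ∫⁻ x, ‖h x‖ₑ ^ 2 * f x ∂ν ≤ ε := by
  -- Under a fixed integral, ∫ h² f is minimized by h proportional to 1/f. Truncation at k keeps the
  -- total mass N finite, while N tends to infinity with k; since ψ f ≤ 1, the normalized function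
  -- costs at most 1/N.
  set ψ : ℕ → α → ℝ≥0∞ := fun k => J.indicator fun x => min (1 / f x) k with hψ
  have hψm : ∀ k, Measurable (ψ k) := fun k =>
    ((hf.const_div 1).min measurable_const).indicator hJ
  have hmono : Monotone ψ := fun k l hkl x =>
    Set.indicator_le_indicator (min_le_min le_rfl (by exact_mod_cast hkl))
  have hsup : ⨆ k, ∫⁻ x, ψ k x ∂ν = ⊤ := by
    rw [← lintegral_iSup hψm hmono, ← hinf, ← lintegral_indicator hJ]
    refine lintegral_congr fun x => ?_
    by_cases hx : x ∈ J
    · simp only [hψ, Set.indicator_of_mem hx]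
      rw [← inf_iSup_eq, ENNReal.iSup_natCast, inf_top_eq]
    · simp [hψ, hx]
  obtain ⟨k, hk⟩ : ∃ k, max 1 ε⁻¹ < ∫⁻ x, ψ k x ∂ν := by
    rw [← lt_iSup_iff, hsup]
    exact max_lt (by simp) (by simpa [pos_iff_ne_zero] using hε)
  set N := ∫⁻ x, ψ k x ∂ν with hN
  have hN0 : N ≠ 0 := fun h => by simp [h] at hk
  have hψk : ∀ x, ψ k x ≤ k := fun x => Set.indicator_apply_le' (fun _ => min_le_right _ _) (by simp)
  have hNt : N ≠ ⊤ := by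
    refine ne_top_of_le_ne_top (ENNReal.mul_ne_top (ENNReal.natCast_ne_top k) hνJ) ?_
    calc N ≤ ∫⁻ x, J.indicator (fun _ => (k : ℝ≥0∞)) x ∂ν :=
          lintegral_mono fun x => Set.indicator_le_indicator (min_le_right _ _)
      _ = k * ν J := by rw [lintegral_indicator hJ, setLIntegral_const]
  have hdiv : ∀ x, ψ k x / N ≠ ⊤ := fun x =>
    ENNReal.div_ne_top (ne_top_of_le_ne_top (ENNReal.natCast_ne_top k) (hψk x)) hN0
  have hm : Measurable fun x => (ψ k x / N).toReal := ((hψm k).div_const N).ennreal_toReal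
  have hint : ∫⁻ x, ψ k x / N ∂ν = 1 := by
    simp only [div_eq_mul_inv]
    rw [lintegral_mul_const _ (hψm k), ENNReal.mul_inv_cancel hN0 hNt]
  have henorm : ∀ x, ‖(ψ k x / N).toReal‖ₑ = ψ k x / N := fun x => by
    rw [Real.enorm_of_nonneg ENNReal.toReal_nonneg, ENNReal.ofReal_toReal (hdiv x)]
  refine ⟨fun x => (ψ k x / N).toReal, hm, fun x => ENNReal.toReal_nonneg,
    ⟨(k / N).toReal, fun x => ENNReal.toReal_mono
      (ENNReal.div_ne_top (ENNReal.natCast_ne_top k) hN0) (ENNReal.div_le_div_right (hψk x) N)⟩,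
    fun x hx => by simp [hψ, hx], ⟨hm.aestronglyMeasurable, ?_⟩, ?_, ?_⟩
  · simp only [HasFiniteIntegral, henorm, hint]
    exact ENNReal.one_lt_top
  · rw [integral_toReal ((hψm k).div_const N).aemeasurable
      (Eventually.of_forall fun x => (hdiv x).lt_top), hint, ENNReal.toReal_one]
  · have hle : ∀ x, ‖(ψ k x / N).toReal‖ₑ ^ 2 * f x ≤ ψ k x / N * N⁻¹ := fun x => by
      have h1 : ψ k x * f x ≤ 1 := by
        refine le_trans (mul_le_mul_left (Set.indicator_apply_le' (a := x) (s := J)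
          (fun _ => min_le_left (1 / f x) (k : ℝ≥0∞)) (by simp)) _) ?_
        rw [one_div]
        exact ENNReal.inv_mul_le_one _
      calc ‖(ψ k x / N).toReal‖ₑ ^ 2 * f x = ψ k x / N * N⁻¹ * (ψ k x * f x) := by
            rw [henorm, div_eq_mul_inv]; ring
        _ ≤ _ := mul_le_of_le_one_right' h1
    calc ∫⁻ x, ‖(ψ k x / N).toReal‖ₑ ^ 2 * f x ∂ν ≤ ∫⁻ x, ψ k x / N * N⁻¹ ∂ν := lintegral_mono hle
      _ = N⁻¹ := by rw [lintegral_mul_const _ ((hψm k).div_const N), hint, one_mul]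
      _ ≤ ε := ENNReal.inv_le_iff_inv_le.1 ((le_max_right _ _).trans hk.le)

/-! ### Vanishing of gradients of zero off the critical set -/

/-- Cauchy–Schwarz after writing |r| = |r| f^{1/2} · f^{-1/2}, legitimate because 0 < f < ∞ a.e. on
J. -/
theorem setLIntegral_enorm_le_eLpNorm_mul {μ : Measure ℝ} {f : ℝ → ℝ≥0∞} (hf : Measurable f)
    {J : Set ℝ} (hft : ∀ᵐ t ∂volume.restrict J, f t ≠ ⊤)
    (hle : (volume.restrict J).withDensity f ≤ μ) (hfin : ∫⁻ t in J, 1 / f t ≠ ⊤)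
    {r : ℝ → ℝ} (hr : Measurable r) :
    ∫⁻ t in J, ‖r t‖ₑ ≤ eLpNorm r 2 μ * (∫⁻ t in J, 1 / f t) ^ (1 / 2 : ℝ) := by
  have hf0 : ∀ᵐ t ∂volume.restrict J, 1 / f t < ⊤ := ae_lt_top (hf.const_div 1) hfin
  have hhalf : ∀ x : ℝ≥0∞, (x ^ (1 / 2 : ℝ)) ^ (2 : ℝ) = x := fun x => by
    rw [← ENNReal.rpow_mul]; norm_num
  calc ∫⁻ t in J, ‖r t‖ₑ
      = ∫⁻ t in J, ((fun t => ‖r t‖ₑ * f t ^ (1 / 2 : ℝ)) * fun t => (1 / f t) ^ (1 / 2 : ℝ)) t := by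
        refine lintegral_congr_ae ?_
        filter_upwards [hft, hf0] with t h1 h2
        have h3 : f t ≠ 0 := fun h => by simp [h] at h2
        rw [Pi.mul_apply, mul_assoc, ← ENNReal.mul_rpow_of_nonneg _ _ (by norm_num), one_div (f t),
          ENNReal.mul_inv_cancel h3 h1, ENNReal.one_rpow, mul_one]
    _ ≤ (∫⁻ t in J, (‖r t‖ₑ * f t ^ (1 / 2 : ℝ)) ^ (2 : ℝ)) ^ (1 / 2 : ℝ) *
        (∫⁻ t in J, ((1 / f t) ^ (1 / 2 : ℝ)) ^ (2 : ℝ)) ^ (1 / 2 : ℝ) :=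
        ENNReal.lintegral_mul_le_Lp_mul_Lq _ Real.HolderConjugate.two_two
          (hr.enorm.mul (hf.pow_const _)).aemeasurable ((hf.const_div 1).pow_const _).aemeasurable
    _ = eLpNorm r 2 ((volume.restrict J).withDensity f) * (∫⁻ t in J, 1 / f t) ^ (1 / 2 : ℝ) := by
        rw [eLpNorm_eq_lintegral_rpow_enorm_toReal (by norm_num) (by norm_num),
          lintegral_withDensity_eq_lintegral_mul _ hf (hr.enorm.pow_const _)]
        simp only [ENNReal.mul_rpow_of_nonneg _ _ zero_le_two, hhalf, Pi.mul_apply, mul_comm,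
          ENNReal.toReal_ofNat]
    _ ≤ _ := by gcongr

/-- Near points where `1/f` is integrable, gradients of zero vanish. -/
theorem ae_restrict_eq_zero_of_mem_gradientSet_zero {μ : Measure ℝ} {f : ℝ → ℝ≥0∞}
    (hf : Measurable f) {J : Set ℝ} (hJ : J.OrdConnected)
    (hft : ∀ᵐ t ∂volume.restrict J, f t ≠ ⊤)
    (hle : (volume.restrict J).withDensity f ≤ μ) (hfin : ∫⁻ t in J, 1 / f t ≠ ⊤)
    {v : Lp ℝ 2 μ} (hv : v ∈ GradientSet μ 0) :
    ∀ᵐ x ∂volume.restrict J, v x = 0 := by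
  obtain ⟨w, hw, hw0, hwv⟩ := hv
  set K := (∫⁻ t in J, 1 / f t) ^ (1 / 2 : ℝ) with hK
  have hKt : K ≠ ⊤ := ENNReal.rpow_ne_top_of_nonneg (by norm_num) hfin
  have hvm : Measurable v := (Lp.stronglyMeasurable v).measurable
  have hw0' : Tendsto (fun n => eLpNorm (w n) 2 μ) atTop (𝓝 0) := by
    refine hw0.congr fun n => eLpNorm_congr_ae ?_
    filter_upwards [Lp.coeFn_zero ℝ 2 μ] with x hx
    rw [hx, Pi.zero_apply, sub_zero]
  have hvi : IntegrableOn v J :=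
    ⟨hvm.aestronglyMeasurable, (setLIntegral_enorm_le_eLpNorm_mul hf hft hle hfin hvm).trans_lt
      (ENNReal.mul_lt_top (Lp.eLpNorm_lt_top v) hKt.lt_top)⟩
  have hbound : ∀ (φ r : ℝ → ℝ) (C : ℝ), Measurable r → (∀ x, ‖φ x‖ ≤ C) → (∀ x ∉ J, φ x = 0) →
      ‖∫ x, φ x * r x‖ₑ ≤ ENNReal.ofReal C * (eLpNorm r 2 μ * K) := by
    intro φ r C hr hC h0
    rw [← setIntegral_eq_integral_of_forall_compl_eq_zero (s := J) (fun x hx => by simp [h0 x hx])]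
    calc ‖∫ x in J, φ x * r x‖ₑ ≤ ∫⁻ x in J, ‖φ x * r x‖ₑ := enorm_integral_le_lintegral_enorm _
      _ ≤ ∫⁻ x in J, ENNReal.ofReal C * ‖r x‖ₑ := lintegral_mono fun x => by
          rw [enorm_mul, ← ofReal_norm (φ x)]; gcongr; exact hC x
      _ = ENNReal.ofReal C * ∫⁻ x in J, ‖r x‖ₑ := lintegral_const_mul _ hr.enorm
      _ ≤ _ := by gcongr; exact setLIntegral_enorm_le_eLpNorm_mul hf hft hle hfin hr
  -- Test against smooth φ supported in the interior: integrating by parts, ∫ φ v = -∫ φ (wₙ' - v) -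
  -- ∫ φ' wₙ, and both terms tend to 0.
  have key : ∀ᵐ x, x ∈ interior J → v x = 0 := by
    refine isOpen_interior.ae_eq_zero_of_integral_contDiff_smul_eq_zero
      (hvi.mono_set interior_subset).locallyIntegrableOn fun φ hφ hφc hφJ => ?_
    simp only [smul_eq_mul]
    have hφd : ContDiff ℝ ∞ (deriv φ) := (contDiff_infty_iff_deriv.1 hφ).2
    obtain ⟨C, hC⟩ := hφc.exists_bound_of_continuous hφ.continuous
    obtain ⟨D, hD⟩ := hφc.deriv.exists_bound_of_continuous hφd.continuous
    have hz : ∀ x ∉ J, φ x = 0 := fun x hx =>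
      image_eq_zero_of_notMem_tsupport fun h => hx (interior_subset (hφJ h))
    have hz' : ∀ x ∉ J, deriv φ x = 0 := fun x hx =>
      image_eq_zero_of_notMem_tsupport fun h =>
        hx (interior_subset (hφJ (closure_minimal (support_deriv_subset) (isClosed_tsupport φ) h)))
    have hest : ∀ n, ‖∫ x, φ x * v x‖ₑ ≤
        ENNReal.ofReal C * (eLpNorm (fun x => deriv (w n) x - v x) 2 μ * K) +
          ENNReal.ofReal D * (eLpNorm (w n) 2 μ * K) := by
      intro n
      have hdw : Continuous (deriv (w n)) := (hw n).continuous_deriv (by simp)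
      have hi1 : Integrable fun x => φ x * v x := by
        have h1 : IntegrableOn (fun x => φ x * v x) J :=
          Integrable.bdd_mul hvi hφ.continuous.aestronglyMeasurable (Eventually.of_forall hC)
        refine (integrableOn_iff_integrable_of_support_subset fun x hx => ?_).1 h1
        by_contra hxJ
        exact hx (by simp [hz x hxJ])
      have hi2 : Integrable fun x => φ x * deriv (w n) x :=
        (hφ.continuous.mul hdw).integrable_of_hasCompactSupport hφc.mul_right
      have hi3 : Integrable fun x => deriv φ x * w n x :=
        (hφd.continuous.mul (hw n).continuous).integrable_of_hasCompactSupport hφc.deriv.mul_right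
      have hi4 : Integrable fun x => φ x * w n x :=
        (hφ.continuous.mul (hw n).continuous).integrable_of_hasCompactSupport hφc.mul_right
      have hparts : ∫ x, φ x * deriv (w n) x = - ∫ x, deriv φ x * w n x :=
        integral_mul_deriv_eq_deriv_mul_of_integrable
          (fun x _ => (hφ.differentiable (by simp) x).hasDerivAt)
          (fun x _ => ((hw n).differentiable (by simp) x).hasDerivAt) hi2 hi3 hi4
      have e : ∫ x, φ x * v x =
          -(∫ x, φ x * (deriv (w n) x - v x)) - ∫ x, deriv φ x * w n x := by
        simp only [mul_sub]
        rw [integral_sub hi2 hi1, hparts]; ring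
      rw [e]
      refine enorm_sub_le.trans ?_
      rw [enorm_neg]
      exact add_le_add (hbound φ _ C (hdw.measurable.sub hvm) hC hz)
        (hbound _ _ D (hw n).continuous.measurable hD hz')
    have hlim : Tendsto (fun n =>
        ENNReal.ofReal C * (eLpNorm (fun x => deriv (w n) x - v x) 2 μ * K) +
          ENNReal.ofReal D * (eLpNorm (w n) 2 μ * K)) atTop (𝓝 0) := by
      have h1 := ENNReal.Tendsto.const_mul (a := ENNReal.ofReal C)
        (ENNReal.Tendsto.mul_const (b := K) hwv (Or.inr hKt)) (Or.inr ENNReal.ofReal_ne_top)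
      have h2 := ENNReal.Tendsto.const_mul (a := ENNReal.ofReal D)
        (ENNReal.Tendsto.mul_const (b := K) hw0' (Or.inr hKt)) (Or.inr ENNReal.ofReal_ne_top)
      simpa using h1.add h2
    have := ge_of_tendsto' hlim hest
    simpa using this
  rw [ae_restrict_iff' hJ.measurableSet]
  have hfr : ∀ᵐ x, x ∉ frontier J :=
    measure_eq_zero_iff_ae_notMem.1 (hJ.convex.addHaar_frontier volume)
  filter_upwards [key, hfr] with x hx hxf hxJ
  refine hx ?_
  by_contra h
  exact hxf ⟨subset_closure hxJ, h⟩

/-- Gradients of zero vanish almost everywhere outside of the critical set. -/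
theorem volume_setOf_notMem_criticalSet_eq_zero {μ : Measure ℝ} {I : Set ℝ} (hI : I.OrdConnected)
    {f : ℝ → ℝ≥0∞} (hf : Measurable f) (hft : ∀ᵐ t ∂volume.restrict I, f t ≠ ⊤)
    (hle : (volume.restrict I).withDensity f ≤ μ) {v : Lp ℝ 2 μ} (hv : v ∈ GradientSet μ 0) :
    volume {x | x ∈ I ∧ x ∉ criticalSet I f ∧ v x ≠ 0} = 0 := by
  refine measure_null_of_locally_null _ fun x hx => ?_
  obtain ⟨ε, hε, hfin⟩ : ∃ ε : ℝ, 0 < ε ∧ ∫⁻ t in I ∩ Metric.ball x ε, 1 / f t ≠ ⊤ := by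
    have := hx.2.1
    simp only [criticalSet, Set.mem_ofPred_eq, not_and, not_forall] at this
    obtain ⟨ε, hε, h⟩ := this hx.1
    exact ⟨ε, hε, h⟩
  have hJ : (I ∩ Metric.ball x ε).OrdConnected := by
    rw [Real.ball_eq_Ioo]; exact hI.inter Set.ordConnected_Ioo
  have hres : volume.restrict (I ∩ Metric.ball x ε) ≤ volume.restrict I :=
    Measure.restrict_mono Set.inter_subset_left le_rfl
  have hleJ : (volume.restrict (I ∩ Metric.ball x ε)).withDensity f ≤ μ := by
    rw [Set.inter_comm, ← Measure.restrict_restrict Metric.isOpen_ball.measurableSet,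
      ← restrict_withDensity Metric.isOpen_ball.measurableSet]
    exact Measure.restrict_le_self.trans hle
  have h := ae_restrict_eq_zero_of_mem_gradientSet_zero hf hJ (ae_mono hres hft) hleJ hfin hv
  rw [ae_restrict_iff' hJ.measurableSet] at h
  refine ⟨_, inter_mem_nhdsWithin _ (Metric.ball_mem_nhds x hε), measure_mono_null ?_ h⟩
  rintro y ⟨⟨hyI, -, hy⟩, hyb⟩
  exact fun h => hy (h ⟨hyI, hyb⟩)

/-! ### Approximation of the indicator of M ∪ S -/

/-- The condition failing at x with radius ε also fails at every y in that ball, with radius ε - |y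
- x|; so M is relatively closed in I. -/
theorem measurableSet_criticalSet {I : Set ℝ} (hI : MeasurableSet I) (f : ℝ → ℝ≥0∞) :
    MeasurableSet (criticalSet I f) := by
  have ho : IsOpen {x : ℝ | ∃ ε : ℝ, 0 < ε ∧ ∫⁻ t in I ∩ Metric.ball x ε, 1 / f t ≠ ⊤} := by
    rw [Metric.isOpen_iff]
    rintro x ⟨ε, hε, h⟩
    refine ⟨ε, hε, fun y hy => ⟨ε - dist y x, sub_pos.2 hy, ne_top_of_le_ne_top h ?_⟩⟩
    exact lintegral_mono_set (Set.inter_subset_inter_right _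
      (Metric.ball_subset_ball' (by linarith)))
  convert hI.inter ho.measurableSet.compl using 1
  ext x
  simp [criticalSet]

/-- On each interval there are functions, small in `L²_μ` up to a negligible set, with the same
integral as the indicator of the critical set. -/
theorem exists_integral_eq_volume_criticalSet {μ : Measure ℝ} {I : Set ℝ} (hI : MeasurableSet I)
    {f : ℝ → ℝ≥0∞} (hf : Measurable f) {S : Set ℝ} (hS : MeasurableSet S)
    (hμS : μ.restrict Sᶜ ≤ (volume.restrict I).withDensity f) (p q : ℝ) {η : ℝ≥0∞} (hη : η ≠ 0) :
    ∃ h : ℝ → ℝ, Measurable h ∧ (∀ x, 0 ≤ h x) ∧ (∃ C, ∀ x, h x ≤ C) ∧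
      (∀ x ∉ Set.Ioc p q, h x = 0) ∧ Integrable h ∧
      ∫ x, h x = volume.real (criticalSet I f ∩ Set.Ioc p q) ∧
      eLpNorm (Sᶜ.indicator h) 2 μ ≤ η := by
  set c := volume.real (criticalSet I f ∩ Set.Ioc p q) with hc
  rcases eq_or_ne c 0 with h0 | h0
  · refine ⟨0, measurable_const, by simp, ⟨0, by simp⟩, by simp, integrable_zero _ _ _, by simp [h0], ?_⟩
    simp
  have hinf : ∫⁻ t in I ∩ Set.Ioc p q, 1 / f t = ⊤ := by
    -- The open cell is needed: a ball around the chosen point of M must fit inside.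
    obtain ⟨x, hxM, hx⟩ : (criticalSet I f ∩ Set.Ioo p q).Nonempty := by
      refine nonempty_of_measure_ne_zero (μ := volume) fun h => h0 ?_
      rw [hc, measureReal_def, ← measure_congr ((ae_eq_refl (criticalSet I f)).inter Ioo_ae_eq_Ioc), h,
        ENNReal.toReal_zero]
    obtain ⟨ε, hε, hb⟩ := Metric.isOpen_iff.1 isOpen_Ioo x hx
    rw [eq_top_iff, ← hxM.2 ε hε]
    exact lintegral_mono_set (Set.inter_subset_inter_right _ (hb.trans Set.Ioo_subset_Ioc_self))
  have hvol : volume (I ∩ Set.Ioc p q) ≠ ⊤ :=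
    ne_top_of_le_ne_top measure_Ioc_lt_top.ne (measure_mono Set.inter_subset_right)
  -- Squared because the cost is a squared norm; divided by c because the unit-mass function is then
  -- multiplied by c.
  have hη' : (η / ‖c‖ₑ) ^ 2 ≠ 0 := pow_ne_zero _ (ENNReal.div_ne_zero.2 ⟨hη, enorm_ne_top⟩)
  obtain ⟨h, hm, hpos, ⟨C, hC⟩, hz, hi, hi1, hsq⟩ :=
    exists_integral_eq_one_lintegral_sq_le (hI.inter measurableSet_Ioc) hvol hf hinf hη'
  have hc0 : 0 ≤ c := measureReal_nonneg
  refine ⟨fun x => c * h x, hm.const_mul c, fun x => mul_nonneg hc0 (hpos x),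
    ⟨c * C, fun x => mul_le_mul_of_nonneg_left (hC x) hc0⟩,
    fun x hx => by simp [hz x fun h => hx h.2], hi.const_mul c, ?_, ?_⟩
  · rw [integral_const_mul, hi1, mul_one]
  · rw [eLpNorm_indicator_eq_eLpNorm_restrict hS.compl]
    refine (eLpNorm_mono_measure _ hμS).trans ?_
    have hL2 : eLpNorm h 2 ((volume.restrict I).withDensity f) ≤ η / ‖c‖ₑ := by
      rw [eLpNorm_eq_lintegral_rpow_enorm_toReal (by norm_num) (by norm_num),
        lintegral_withDensity_eq_lintegral_mul _ hf (hm.enorm.pow_const _)]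
      have h1 : ∫⁻ x in I, (f * fun x => ‖h x‖ₑ ^ (2 : ℝ≥0∞).toReal) x ≤ (η / ‖c‖ₑ) ^ 2 := by
        refine ((setLIntegral_le_lintegral _ _).trans_eq (lintegral_congr fun x => ?_)).trans hsq
        simp [mul_comm]
      refine (ENNReal.rpow_le_rpow h1 (by norm_num)).trans_eq ?_
      rw [← ENNReal.rpow_natCast, ← ENNReal.rpow_mul]
      norm_num
    have := eLpNorm_const_smul c h 2 ((volume.restrict I).withDensity f)
    calc eLpNorm (fun x => c * h x) 2 ((volume.restrict I).withDensity f)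
        = ‖c‖ₑ * eLpNorm h 2 ((volume.restrict I).withDensity f) := this
      _ ≤ ‖c‖ₑ * (η / ‖c‖ₑ) := by gcongr
      _ ≤ η := ENNReal.mul_div_le

/-- Two nonnegative functions carried by `Ioc p q` with the same integral have primitives that agree
outside of `Ioc p q` and differ by at most this integral. -/
theorem abs_setIntegral_sub_le_indicator {u h : ℝ → ℝ} {a p q x : ℝ} (hap : a ≤ p)
    (hu : Integrable u) (hh : Integrable h) (hu0 : ∀ x, 0 ≤ u x) (hh0 : ∀ x, 0 ≤ h x)
    (huz : ∀ x ∉ Set.Ioc p q, u x = 0) (hhz : ∀ x ∉ Set.Ioc p q, h x = 0)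
    (he : ∫ x, h x = ∫ x, u x) :
    |∫ t in Set.Ioc a x, (u t - h t)| ≤ (Set.Ioc p q).indicator (fun _ => ∫ x, u x) x := by
  rw [integral_sub hu.integrableOn hh.integrableOn]
  by_cases hx : x ∈ Set.Ioc p q
  · rw [Set.indicator_of_mem hx, abs_le]
    have h1 := setIntegral_le_integral (s := Set.Ioc a x) hu (Eventually.of_forall hu0)
    have h2 := setIntegral_le_integral (s := Set.Ioc a x) hh (Eventually.of_forall hh0)
    have h3 : 0 ≤ ∫ t in Set.Ioc a x, u t := integral_nonneg hu0
    have h4 : 0 ≤ ∫ t in Set.Ioc a x, h t := integral_nonneg hh0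
    constructor <;> linarith
  · rw [Set.indicator_of_notMem hx]
    rcases le_or_gt x p with hxp | hxp
    · have hz : ∀ r : ℝ → ℝ, (∀ x ∉ Set.Ioc p q, r x = 0) → ∫ t in Set.Ioc a x, r t = 0 :=
        fun r hr => setIntegral_eq_zero_of_forall_eq_zero fun t ht =>
          hr t fun h => (h.1.trans_le (ht.2.trans hxp)).false
      simp [hz u huz, hz h hhz]
    · have hqx : q ≤ x := by
        by_contra hqx
        exact hx ⟨hxp, (not_le.1 hqx).le⟩
      have hz : ∀ r : ℝ → ℝ, (∀ x ∉ Set.Ioc p q, r x = 0) → ∫ t in Set.Ioc a x, r t = ∫ t, r t :=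
        fun r hr => setIntegral_eq_integral_of_forall_compl_eq_zero fun t ht =>
          hr t fun h => ht ⟨hap.trans_lt h.1, h.2.trans hqx⟩
      simp [hz u huz, hz h hhz, he]

/-- The indicator of the critical set and of a set carrying the singular part is a limit of functions
with small primitives. -/
theorem exists_eLpNorm_sub_indicator_le {μ : Measure ℝ} [IsFiniteMeasure μ] {a b : ℝ} (hab : a < b)
    {I : Set ℝ} (hI : MeasurableSet I) {f : ℝ → ℝ≥0∞} (hf : Measurable f)
    {S : Set ℝ} (hS : MeasurableSet S) (hS0 : volume S = 0)
    (hμS : μ.restrict Sᶜ ≤ (volume.restrict I).withDensity f) {ε : ℝ} (hε : 0 < ε) :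
    ∃ g : ℝ → ℝ, MemLp g 2 (μ + volume.restrict (Set.Icc a b)) ∧
      (∀ x ∈ Set.Icc a b, |∫ t in a..x, g t| ≤ ε) ∧
      eLpNorm (fun x => g x - (criticalSet I f ∪ S).indicator 1 x) 2 μ ≤ ENNReal.ofReal ε := by
  set M := criticalSet I f with hM
  have hMm : MeasurableSet M := measurableSet_criticalSet hI f
  -- The n cells have length δ ≤ ε, which bounds the primitive; an L²_μ error of ε / n per cell adds
  -- up to ε.
  obtain ⟨n, hn⟩ := exists_nat_gt ((b - a) / ε)
  have hn0 : (0 : ℝ) < n := (div_pos (sub_pos.2 hab) hε).trans hn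
  set δ := (b - a) / n with hδ
  have hδ0 : 0 < δ := div_pos (sub_pos.2 hab) hn0
  have hδε : δ ≤ ε := by
    rw [hδ, div_le_iff₀ hn0]; rw [div_lt_iff₀ hε] at hn; linarith
  set p : ℕ → ℝ := fun k => a + k * δ with hp
  have hpm : Monotone p := fun k l hkl => by
    have : (k : ℝ) ≤ l := by exact_mod_cast hkl
    simp only [hp]; gcongr
  have hp0 : p 0 = a := by simp [hp]
  have hpn : p n = b := by simp only [hp, hδ]; field_simp; ring
  have hη : ENNReal.ofReal (ε / n) ≠ 0 := by simpa using div_pos hε hn0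
  choose h hm hpos hC hz hi hint hnorm using fun k : ℕ =>
    exists_integral_eq_volume_criticalSet hI hf hS hμS (p k) (p (k + 1)) hη
  set u : ℕ → ℝ → ℝ := fun k => (M ∩ Set.Ioc (p k) (p (k + 1))).indicator 1 with hu
  have hcell : ∀ k, volume.real (M ∩ Set.Ioc (p k) (p (k + 1))) ≤ δ := fun k => by
    refine (measureReal_mono Set.inter_subset_right measure_Ioc_lt_top.ne).trans_eq ?_
    rw [Real.volume_real_Ioc_of_le (hpm (Nat.le_succ k))]
    simp only [hp]; push_cast; ring
  have hum : ∀ k, MeasurableSet (M ∩ Set.Ioc (p k) (p (k + 1))) := fun k => hMm.inter measurableSet_Ioc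
  have hui : ∀ k, Integrable (u k) := fun k =>
    (integrable_indicator_iff (hum k)).2 (integrableOn_const
      (ne_top_of_le_ne_top measure_Ioc_lt_top.ne (measure_mono Set.inter_subset_right)))
  have huint : ∀ k, ∫ x, u k x = volume.real (M ∩ Set.Ioc (p k) (p (k + 1))) := fun k =>
    integral_indicator_one (hum k)
  have hdisj := hpm.pairwise_disjoint_on_Ioc_succ
  have hcover : ∀ x ∈ Set.Ioc a b, ∃ k < n, x ∈ Set.Ioc (p k) (p (k + 1)) := fun x hx => by
    have := hpm.biUnion_Ico_Ioc_map_succ 0 n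
    rw [hp0, hpn] at this
    rw [← this] at hx
    simpa [and_left_comm] using hx
  have hsum : ∀ x ∈ Set.Ioc a b, M.indicator (1 : ℝ → ℝ) x = ∑ k ∈ Finset.range n, u k x := by
    intro x hx
    obtain ⟨j, hj, hxj⟩ := hcover x hx
    rw [Finset.sum_eq_single_of_mem j (Finset.mem_range.2 hj)]
    · by_cases hxM : x ∈ M <;> simp [hu, hxM, hxj.1, hxj.2]
    · intro k _ hkj
      exact Set.indicator_of_notMem (fun hxk => Set.disjoint_left.1 (hdisj hkj) hxk.2 hxj) _
  -- The compensators are cut off on S, where their μ-norm is not controlled; S being Lebesgue-null,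
  -- primitives do not change.
  set g : ℝ → ℝ := fun x =>
    (M ∪ S).indicator 1 x - ∑ k ∈ Finset.range n, Sᶜ.indicator (h k) x with hg
  have hmemh : ∀ (k : ℕ) (ν : Measure ℝ) [IsFiniteMeasure ν], MemLp (Sᶜ.indicator (h k)) 2 ν := by
    intro k ν _
    obtain ⟨C, hC⟩ := hC k
    refine (MemLp.of_bound (hm k).aestronglyMeasurable C (Eventually.of_forall fun x => ?_)).indicator
      hS.compl
    rw [Real.norm_of_nonneg (hpos k x)]
    exact hC x
  refine ⟨g, ?_, ?_, ?_⟩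
  · refine MemLp.sub ?_ (memLp_finsetSum _ fun k _ => hmemh k _)
    exact memLp_indicator_const 2 (hMm.union hS) 1 (Or.inr (measure_ne_top _ _))
  · intro x hx
    rw [intervalIntegral.integral_of_le hx.1]
    have e : ∫ t in Set.Ioc a x, g t = ∑ k ∈ Finset.range n, ∫ t in Set.Ioc a x, (u k t - h k t) := by
      rw [← integral_finsetSum (f := fun k t => u k t - h k t) _
        fun k _ => ((hui k).sub (hi k)).integrableOn]
      refine setIntegral_congr_ae measurableSet_Ioc ?_
      filter_upwards [measure_eq_zero_iff_ae_notMem.1 hS0] with t htS ht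
      have h1 : (M ∪ S).indicator (1 : ℝ → ℝ) t = M.indicator 1 t := by
        by_cases htM : t ∈ M <;> simp [htM, htS]
      simp only [hg, h1, hsum t ⟨ht.1, ht.2.trans hx.2⟩, Finset.sum_sub_distrib]
      simp [htS]
    have hb : ∀ k, |∫ t in Set.Ioc a x, (u k t - h k t)| ≤
        (Set.Ioc (p k) (p (k + 1))).indicator (fun _ => δ) x := fun k => by
      refine (abs_setIntegral_sub_le_indicator (hp0 ▸ hpm (Nat.zero_le k)) (hui k) (hi k)
        (fun x => Set.indicator_nonneg (fun _ _ => zero_le_one) x) (hpos k)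
        (fun x hx => Set.indicator_of_notMem (fun h => hx h.2) _) (hz k)
        ((hint k).trans (huint k).symm)).trans ?_
      exact Set.indicator_le_indicator ((huint k).trans_le (hcell k))
    rw [e]
    refine (Finset.abs_sum_le_sum_abs _ _).trans ((Finset.sum_le_sum fun k _ => hb k).trans ?_)
    -- No half-open cell contains a, so x = a is separate.
    rcases eq_or_lt_of_le hx.1 with rfl | hax
    · refine (Finset.sum_nonpos fun k _ => ?_).trans hε.le
      refine (Set.indicator_of_notMem (fun h => ?_) _).le
      exact (h.1.trans_le (hp0 ▸ hpm (Nat.zero_le k))).false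
    obtain ⟨j, hj, hxj⟩ := hcover x ⟨hax, hx.2⟩
    rw [Finset.sum_eq_single_of_mem j (Finset.mem_range.2 hj), Set.indicator_of_mem hxj]
    · exact hδε
    · intro k _ hkj
      exact Set.indicator_of_notMem (fun hxk => Set.disjoint_left.1 (hdisj hkj) hxk hxj) _
  · have e : (fun x => g x - (M ∪ S).indicator 1 x) =
        -∑ k ∈ Finset.range n, Sᶜ.indicator (h k) := by
      ext x; simp [hg]
    rw [e, eLpNorm_neg]
    refine (eLpNorm_sum_le (fun k _ => (hmemh k μ).aestronglyMeasurable) (by norm_num)).trans ?_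
    refine (Finset.sum_le_sum fun k _ => hnorm k).trans_eq ?_
    rw [Finset.sum_const, Finset.card_range, nsmul_eq_mul, ← ENNReal.ofReal_natCast,
      ← ENNReal.ofReal_mul hn0.le, mul_div_cancel₀ _ hn0.ne']

/-! ### Identification of ξ and of the tangent space -/

/-- The function `ξ` is the indicator of the union of the critical set and of a set carrying the
singular part. -/
theorem xi_ae_eq_indicator {μ : Measure ℝ} [IsFiniteMeasure μ] {I : Set ℝ} (hI : I.OrdConnected)
    (hIb : Bornology.IsBounded I) (hμI : μ Iᶜ = 0) {f : ℝ → ℝ≥0∞} (hf : Measurable f)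
    (hle : (volume.restrict I).withDensity f ≤ μ)
    {S : Set ℝ} (hS : MeasurableSet S) (hS0 : volume S = 0)
    (hμS : μ.restrict Sᶜ ≤ (volume.restrict I).withDensity f) :
    xi μ =ᵐ[μ] (criticalSet I f ∪ S).indicator 1 := by
  obtain ⟨R, hR⟩ := hIb.subset_closedBall 0
  rw [Real.closedBall_eq_Icc] at hR
  have hIR : I ⊆ Set.Icc (0 - (|R| + 1)) (0 + (|R| + 1)) := hR.trans
    (Set.Icc_subset_Icc (by linarith [le_abs_self R]) (by linarith [le_abs_self R]))
  have hRlt : 0 - (|R| + 1) < 0 + (|R| + 1) := by linarith [abs_nonneg R]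
  have hMS : MeasurableSet (criticalSet I f ∪ S) :=
    (measurableSet_criticalSet hI.measurableSet f).union hS
  set χ : Lp ℝ 2 μ := indicatorConstLp 2 hMS (measure_ne_top μ _) (1 : ℝ) with hχ
  have hχe : χ =ᵐ[μ] (criticalSet I f ∪ S).indicator 1 := indicatorConstLp_coeFn
  have hft : ∀ᵐ t ∂volume.restrict I, f t ≠ ⊤ := by
    refine (ae_lt_top hf (ne_top_of_le_ne_top (measure_ne_top μ Set.univ) ?_)).mono fun t h => h.ne
    rw [← setLIntegral_univ, ← withDensity_apply _ MeasurableSet.univ]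
    exact hle _
  have hmem : χ ∈ gradientsOfZero μ := by
    refine mem_gradientSet_zero_of_primitive_small
      (measure_mono_null (Set.compl_subset_compl.2 hIR) hμI) fun ε hε => ?_
    obtain ⟨g, hg, hg1, hg2⟩ :=
      exists_eLpNorm_sub_indicator_le hRlt hI.measurableSet hf hS hS0 hμS hε
    refine ⟨g, hg, hg1, (eLpNorm_congr_ae ?_).trans_le hg2⟩
    filter_upwards [hχe] with x hx
    rw [hx]
  have hvan : ∀ v ∈ gradientsOfZero μ, ∀ᵐ x ∂μ, x ∉ criticalSet I f ∪ S → v x = 0 := by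
    intro v hv
    have hN : μ ({x | x ∈ I ∧ x ∉ criticalSet I f ∧ v x ≠ 0} ∩ Sᶜ) = 0 := by
      rw [← Measure.restrict_apply' hS.compl]
      refine le_antisymm ((hμS _).trans_eq ?_) zero_le
      exact withDensity_absolutelyContinuous _ _ (Measure.restrict_le_self.absolutelyContinuous
        (volume_setOf_notMem_criticalSet_eq_zero hI hf hft hle hv))
    have hμI' : ∀ᵐ x ∂μ, x ∈ I := hμI
    filter_upwards [hμI', measure_eq_zero_iff_ae_notMem.1 hN] with x hxI hxN hx
    by_contra hvx
    exact hxN ⟨⟨hxI, fun h => hx (Or.inl h), hvx⟩, fun h => hx (Or.inr h)⟩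
  have hxi : xi μ = χ := by
    refine Submodule.eq_starProjection_of_mem_of_inner_eq_zero hmem fun v hv => ?_
    rw [L2.inner_def]
    refine integral_eq_zero_of_ae ?_
    filter_upwards [hvan v hv, hχe, Lp.coeFn_sub (Lp.const 2 μ (1 : ℝ)) χ,
      Lp.coeFn_const (p := 2) (μ := μ) (1 : ℝ)] with x hxv hxχ hsub hone
    by_cases hx : x ∈ criticalSet I f ∪ S
    · have h0 : (Lp.const 2 μ (1 : ℝ) - χ : Lp ℝ 2 μ) x = 0 := by
        rw [hsub, Pi.sub_apply, hone, hxχ, Set.indicator_of_mem hx, Function.const_apply,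
          Pi.one_apply, sub_self]
      rw [h0, inner_zero_left, Pi.zero_apply]
    · simp [hxv hx]
  rw [hxi]
  exact hχe

theorem criticalSet_congr {I : Set ℝ} {f f' : ℝ → ℝ≥0∞} (h : f =ᵐ[volume.restrict I] f') :
    criticalSet I f = criticalSet I f' := by
  have e : ∀ x ε : ℝ, ∫⁻ t in I ∩ Metric.ball x ε, 1 / f t = ∫⁻ t in I ∩ Metric.ball x ε, 1 / f' t :=
    fun x ε => lintegral_congr_ae <| by
      filter_upwards [ae_mono (Measure.restrict_mono Set.inter_subset_left le_rfl) h] with t ht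
      rw [ht]
  simp only [criticalSet, e]

end ZhikovTangent

theorem theorem2p1 (I : Set ℝ) (hI : I.OrdConnected) (hIb : Bornology.IsBounded I)
    (μ : Measure ℝ) [IsFiniteMeasure μ] (hμI : μ Iᶜ = 0)
    (f : ℝ → ℝ≥0∞) (hf : AEMeasurable f (volume.restrict I))
    (hμ : μ = (volume.restrict I).withDensity f + μ.singularPart volume)
    (A : Set ℝ) (hA : volume A = 0) (hμA : μ.singularPart volume Aᶜ = 0) :
    ∀ᵐ x ∂μ,
      (x ∈ ZhikovTangent.criticalSet I f ∪ A → ZhikovTangent.tangentSpace μ x = ⊥) ∧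
      (x ∉ ZhikovTangent.criticalSet I f ∪ A → ZhikovTangent.tangentSpace μ x = ⊤) := by
  rw [withDensity_congr_ae hf.ae_eq_mk] at hμ
  rw [ZhikovTangent.criticalSet_congr hf.ae_eq_mk]
  obtain ⟨T, hT, hT0, hTv⟩ := Measure.mutuallySingular_singularPart μ volume
  have hle : (volume.restrict I).withDensity (hf.mk f) ≤ μ := by
    conv_rhs => rw [hμ]
    exact Measure.le_add_right le_rfl
  have hμS : μ.restrict Tᶜᶜ ≤ (volume.restrict I).withDensity (hf.mk f) := by
    rw [compl_compl]
    conv_lhs => rw [hμ]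
    rw [Measure.restrict_add, Measure.restrict_eq_zero.2 hT0, add_zero]
    exact Measure.restrict_le_self
  have hnull : ∀ N : Set ℝ, volume N = 0 → μ.singularPart volume N = 0 → μ N = 0 := by
    intro N hN hN'
    rw [hμ, Measure.add_apply, hN', add_zero]
    exact withDensity_absolutelyContinuous _ _
      (Measure.restrict_le_self.absolutelyContinuous hN)
  -- Both A and `Tᶜ` are Lebesgue-null and carry the singular part, so they agree up to a μ-null
  -- set; A need not be measurable.
  have h1 : μ (A \ Tᶜ) = 0 := hnull _ (measure_mono_null Set.sdiff_subset hA)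
    (measure_mono_null (fun x hx => not_not.1 hx.2) hT0)
  have h2 : μ (Tᶜ \ A) = 0 := hnull _ (measure_mono_null Set.sdiff_subset hTv)
    (measure_mono_null (fun x hx => hx.2) hμA)
  filter_upwards [ZhikovTangent.xi_ae_eq_indicator hI hIb hμI hf.measurable_mk hle hT.compl hTv hμS,
    measure_eq_zero_iff_ae_notMem.1 h1, measure_eq_zero_iff_ae_notMem.1 h2] with x hx hx1 hx2
  have hAT : x ∈ A ↔ x ∈ Tᶜ :=
    ⟨fun h => by_contra fun h' => hx1 ⟨h, h'⟩, fun h => by_contra fun h' => hx2 ⟨h, h'⟩⟩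
  rw [ZhikovTangent.tangentSpace, Set.mem_union, hAT, ← Set.mem_union]
  refine ⟨fun h => ?_, fun h => ?_⟩
  · rw [hx, Set.indicator_of_mem h, Pi.one_apply, Ideal.submodule_span_eq,
      Ideal.span_singleton_one, Submodule.top_orthogonal_eq_bot]
  · rw [hx, Set.indicator_of_notMem h, Submodule.span_zero_singleton, Submodule.bot_orthogonal_eq_top]
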